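/- **Theorem 5.** *MTBNs.* A digraph $(V,E)$ (of any cardinality) is *well-founded* if it has no infinite ancestor chain $v_0\leftarrow v_1\leftarrow v_2\leftarrow\cdots$. A *measure-theoretic Bayesian network* (MTBN) consists of a well-founded digraph $(V,E)$, an arbitrary measurable space $\mathcal X_v$ for each $v\in V$, and a probability kernel $K_v$ from $\prod_{u\in \mathrm{pa}(v)}\mathcal X_u$ to $\mathcal X_v$ for each $v\in V$, where $\mathrm{pa}(v)$ is the set of parents of $v$. It *represents* a probability measure $\mu$ on $\mathcal X_V=\prod_{v\in V}\mathcal X_v$ (with coordinate projections $X_v$) if for all $v\in V$: (i) under $\mu$, $X_v$ is conditionally independent of $(X_u)_{u\in \mathrm{nd}(v)}$ given $X_{\mathrm{pa}(v)}$, where $\mathrm{nd}(v)$ is the set of vertices that cannot be reached from $v$ by a directed path of length $\ge 0$; and (ii) for every measurable $A\subseteq\mathcal X_v$, $K_v(X_{\mathrm{pa}(v)},A)=\mathbb P_\mu[X_v\in A\mid X_{\mathrm{pa}(v)}]$ $\mu$-almost surely. *BLOG models.* A measure-theoretic BLOG model $\mathcal M$ declares (at most countably many) types with (at most countably many) distinct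 constants; built-in value types with arbitrary measurable spaces; at most countably many number statements $\#\tau(g_1=x_1,\dots,g_k=x_k)\sim D$ with distinct origin functions $g_j$ from $\tau$ to the type of $x_j$; and function symbols $f(x_1,\dots,x_k)$ that are either fixed, with an interpretation $\tilde f$, or random, with a dependency statement $f(\bar x)\sim D$. A right-hand side $D$ is built from distributions $c(\bar e)$ (where $c$ specifies a probability kernel and $\bar e$ is a tuple of expressions), mixtures $\mathrm{Mix}(\{D_1\to w_1(\bar e'),\dots,D_m\to w_m(\bar e')\})$ with measurable nonnegative weights that sum to $1$ for all values of $\bar e'$, and case distinctions "if $\varphi$ then $D_1$ else $D_2$" with first-order formulas $\varphi$. Expressions and formulas are built from variables, distinct constants, function symbols, origin functions, measurable built-in operations, equality, connectives, quantifiers $\forall z{:}\tau$, $\exists z{:}\tau$, and set expressions $\{z \text{ for } \tau\ z:\varphi\}$; bound variables range over the existing objects. The *possible elements* are the distinct constants and, recursively, the elements $u_{\nu,\bar u,i}$, $i\ge1$, of type $\tau$, for every number statement $\nu$ of type $\tau$ and every tuple $\bar u$ of possible elements of the types of its arguments. The *basic random variables* $BRV(\mathcal M)$ are the number variables $V_\nu[\bar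 u]$ with space $\mathbb N$, and the variables $V_f[\bar u]$ for every random, fixed or origin function $f$, whose space consists of the values of the return type of $f$ (its possible elements with the discrete $\sigma$-algebra, or the built-in space) and an additional isolated value *null*. The element $u_{\nu,\bar u,i}$ exists under an assignment $\sigma$ if $\sigma(V_\nu[\bar u])\ge i$; constants always exist. *Its graph and kernels.* The parents of $V_s[\bar u]$ are: (a) $V_\nu[\bar v]$ for every element $u_{\nu,\bar v,i}$ that occurs in $\bar u$; (b) $V_g[\bar w]$ for every application $g(\bar t)$ that appears in the statement of $s$ and every tuple $\bar w$ that $\bar t$ can denote once $\bar u$ is substituted for the arguments $\bar x$ of $s$ and arbitrary elements $\bar u'$ of the right types are substituted for the bound variables (if $\bar t$ consists of variables, $\bar w$ is $\bar t[\bar u/\bar x][\bar u'/\bar z]$; constants and built-in, fixed and origin functions are evaluated, and a random subterm can denote anything); (c) $V_\nu[\bar v]$ for every element $u_{\nu,\bar v,i}$ that is substituted for a bound variable. The kernel $K_{V_s[\bar u]}$ evaluates the right-hand side of the statement of $s$ at $\bar u$, as a function of the values of the parents; for fixed $f$ it is the unit mass at $\tilde f(\bar u)$, and for an origin function $g$ the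 unit mass at $v_j$ if the argument is $u_{\nu,\bar v,i}$ and $g$ is the $j$-th origin function of $\nu$ (at *null* if there is no such $j$). If however an element of $\bar u$ does not exist, then the kernel is the unit mass at *null* ($0$ for a number variable). *Claim.* If the graph of $\mathcal M$ is a well-founded digraph, then the MTBN formed by $BRV(\mathcal M)$, this graph, these spaces and these kernels represents a unique probability measure $\mu$ on $\mathcal X_{BRV(\mathcal M)}$. -/

import Mathlib

open MeasureTheory ProbabilityTheory
open scoped NNReal ENNReal

/-! ## Measure-theoretic Bayesian networks -/

/-- A digraph with edge relation `E` (`E u v` is the edge `u → v`) is well-founded if there is no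
infinite ancestor chain `a 0 ← a 1 ← a 2 ← ⋯`. -/
def WellFoundedDigraph {V : Type*} (E : V → V → Prop) : Prop :=
  ¬ ∃ a : ℕ → V, ∀ n, E (a (n + 1)) (a n)

/-- A measure-theoretic Bayesian network with vertex set `V`: a well-founded digraph, a measurable
space for every vertex, and for every vertex a probability kernel from the product of the spaces
of its parents. -/
structure MTBN (V : Type*) where
  /-- `Edge u v` is the edge `u → v`. -/
  Edge : V → V → Prop
  wellFounded : WellFoundedDigraph Edge
  X : V → Type*
  [mX : ∀ v, MeasurableSpace (X v)]
  K : ∀ v, Kernel (∀ u : {u // Edge u v}, X u.1) (X v)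
  markov : ∀ v, IsMarkovKernel (K v)

attribute [instance] MTBN.mX

/-- Conditional independence of the σ-algebras `m₁`, `m₂` given `m`, through conditional
probabilities (Mathlib's `CondIndep` is restricted to standard Borel spaces; the product of the
spaces of uncountably many vertices is not of that kind). -/
def CondIndepGiven {Ω : Type*} (m m₁ m₂ : MeasurableSpace Ω) {_mΩ : MeasurableSpace Ω}
    (μ : Measure Ω) : Prop :=
  ∀ A B : Set Ω, MeasurableSet[m₁] A → MeasurableSet[m₂] B →
    μ⟦A ∩ B | m⟧ =ᵐ[μ] μ⟦A | m⟧ * μ⟦B | m⟧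

namespace MTBN

variable {V : Type*} (M : MTBN V)

/-- Parents of `v`. -/
def pa (v : V) : Set V := {u | M.Edge u v}

/-- Non-descendants of `v`: the vertices that no directed path (of length `≥ 0`) from `v`
reaches. In particular `v` is not one of them. -/
def nd (v : V) : Set V := {u | ¬ Relation.ReflTransGen M.Edge v u}

/-- The σ-algebra on the full product space that is generated by the projection `X_U` to the
coordinates in `U`. -/
@[reducible] def sigma (U : Set V) : MeasurableSpace (∀ v, M.X v) :=
  MeasurableSpace.comap (fun x (u : U) => x u.1) inferInstance

/-- `M` represents the measure `μ` on the product space: every `X_v` is conditionally independent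
of its non-descendants given its parents, and `K_v` is a version of the conditional distribution
of `X_v` given its parents. -/
def Represents (μ : Measure (∀ v, M.X v)) : Prop :=
  ∀ v : V,
    CondIndepGiven (M.sigma (M.pa v)) (M.sigma {v}) (M.sigma (M.nd v)) μ ∧
    ∀ A : Set (M.X v), MeasurableSet A →
      (fun x => (M.K v (fun u => x u.1) A).toReal) =ᵐ[μ]
        μ⟦(fun x : ∀ v, M.X v => x v) ⁻¹' A | M.sigma (M.pa v)⟧

end MTBN

/-! ## Measure-theoretic BLOG: vocabulary, possible elements, values -/

namespace BLOG

/-- The vocabulary of a BLOG model. -/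
structure Vocab where
  /-- Types whose elements are the distinct constants and the objects generated by number
  statements (user types; also for instance time steps, with constants `0, 1, 2, …`). -/
  Ty : Type
  /-- Built-in value types, such as `Real` or `Bool`, with an arbitrary measurable space. -/
  BTy : Type
  carrier : BTy → Type
  [mcarrier : ∀ b, MeasurableSpace (carrier b)]
  /-- The distinct constants of each type. -/
  Const : Ty → Type
  /-- Origin functions `origin (orgCod g) g (orgDom g)`. -/
  Org : Type
  orgDom : Org → Ty
  orgCod : Org → Ty
  /-- Number statements `#(numTy ν)(g₁ = x₁, …, g_k = x_k)`. The type of `x_j` is the return type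
  of the origin function `g_j = numOrg ν j`. -/
  Num : Type
  numTy : Num → Ty
  numArity : Num → ℕ
  numOrg : ∀ ν, Fin (numArity ν) → Org
  numOrg_dom : ∀ ν j, orgDom (numOrg ν j) = numTy ν
  numOrg_injective : ∀ ν, Function.Injective (numOrg ν)
  /-- Random and fixed function symbols, with their argument types and their return type, which
  is either in `Ty` or built-in. -/
  Fn : Type
  fnArity : Fn → ℕ
  fnArg : ∀ f, Fin (fnArity f) → Ty
  fnRet : Fn → Ty ⊕ BTy
  [countable_Ty : Countable Ty]
  [countable_Const : ∀ τ, Countable (Const τ)]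
  [countable_Num : Countable Num]

attribute [instance] Vocab.mcarrier Vocab.countable_Ty Vocab.countable_Const Vocab.countable_Num

namespace Vocab

variable (S : Vocab)

/-- The type of the `j`-th argument of a number statement. -/
def numArg (ν : S.Num) (j : Fin (S.numArity ν)) : S.Ty := S.orgCod (S.numOrg ν j)

/-- The possible elements of each type: the distinct constants, and the elements
`gen ν u i`, where `ν` is a number statement of that type, `u` a tuple of possible elements of the
types of its arguments, and `i : ℕ`. Indices start at `0`: `gen ν u i` is the `(i+1)`-st object
that `ν` generates for `u`. -/
inductive Elem : S.Ty → Type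
  | con {τ : S.Ty} (c : S.Const τ) : Elem τ
  | gen (ν : S.Num) (u : ∀ j : Fin (S.numArity ν), Elem (S.numArg ν j)) (i : ℕ) :
      Elem (S.numTy ν)

variable {S}

/-- Auxiliary: shapes of elements, used only for countability. -/
abbrev Shape (S : Vocab) : Type := (Σ τ, S.Const τ) ⊕ (S.Num × ℕ)

/-- Auxiliary: arity of a shape. -/
def Shape.arity : Shape S → ℕ
  | .inl _ => 0
  | .inr p => S.numArity p.1

/-- Auxiliary: the tree of an element. -/
def Elem.tree : ∀ {τ : S.Ty}, S.Elem τ → WType (fun a : Shape S => Fin a.arity)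
  | τ, .con c => ⟨.inl ⟨τ, c⟩, fun j => j.elim0⟩
  | _, .gen ν u i => ⟨.inr (ν, i), fun j => (u j).tree⟩

theorem Elem.tree_inj {τ τ₁ : S.Ty} (a : S.Elem τ) (b : S.Elem τ₁) (h : a.tree = b.tree) :
    τ = τ₁ ∧ a ≍ b := by
  induction a generalizing τ₁ with
  | con c =>
    cases b with
    | con c₁ =>
      simp only [Elem.tree, WType.mk.injEq, Sum.inl.injEq] at h
      obtain ⟨h, -⟩ := h
      cases h
      exact ⟨rfl, HEq.rfl⟩
    | gen => simp [Elem.tree] at h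
  | gen ν u i ih =>
    cases b with
    | con c₁ => simp [Elem.tree] at h
    | gen ν₁ u₁ i₁ =>
      simp only [Elem.tree, WType.mk.injEq, Sum.inr.injEq, Prod.mk.injEq] at h
      obtain ⟨⟨rfl, rfl⟩, h⟩ := h
      have h := eq_of_heq h
      have : u = u₁ := funext fun j => eq_of_heq (ih j (u₁ j) (congrFun h j)).2
      subst this
      exact ⟨rfl, HEq.rfl⟩

instance (τ : S.Ty) : Countable (S.Elem τ) := by
  have : Encodable (Shape S) := Encodable.ofCountable _
  exact Function.Injective.countable (f := Elem.tree)
    fun a b h => eq_of_heq (Elem.tree_inj a b h).2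

/-- The value of the origin function `g` on an element: `g_j (gen ν u i) = u_j` if `g_j` is the
`j`-th origin function of `ν`; `null` (`none`) if `g` was not used in the generation of the
element. -/
noncomputable def Elem.origin (g : S.Org) : ∀ {τ : S.Ty}, S.Elem τ → Option (S.Elem (S.orgCod g))
  | _, .con _ => none
  | _, .gen ν u _ =>
    open Classical in
    if h : ∃ j, S.numOrg ν j = g then some (h.choose_spec ▸ u h.choose) else none

variable (S) in
/-- The values of a type: its possible elements, or the points of the built-in space, and
additionally the special value `null`, which is `none`. -/
def TVal : S.Ty ⊕ S.BTy → Type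
  | .inl τ => Option (S.Elem τ)
  | .inr b => Option (S.carrier b)

/-- The value `null`. -/
def null : ∀ t, S.TVal t
  | .inl _ => none
  | .inr _ => none

/-- Possible elements form a (countable) discrete space; `null` is an isolated point that is added
to the space of a built-in type. -/
instance : ∀ t, MeasurableSpace (S.TVal t)
  | .inl _ => ⊤
  | .inr _ => MeasurableSpace.map some inferInstance

variable (S) in
/-- Sorts of expressions: a type, truth values, or sets of elements of a type. -/
inductive Srt : Type
  | ty (t : S.Ty ⊕ S.BTy)
  | prop
  | set (τ : S.Ty)

/-- Expressions of a type in `Ty`. -/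
abbrev Srt.obj (τ : S.Ty) : S.Srt := .ty (.inl τ)

variable (S) in
/-- The values of each sort. -/
def Val : S.Srt → Type
  | .ty t => S.TVal t
  | .prop => Prop
  | .set τ => Set (S.Elem τ)

instance : ∀ s, MeasurableSpace (S.Val s)
  | .ty t => inferInstanceAs (MeasurableSpace (S.TVal t))
  | .prop => inferInstanceAs (MeasurableSpace Prop)
  | .set τ => inferInstanceAs (MeasurableSpace (Set (S.Elem τ)))

instance (τ : S.Ty) : Countable (S.Val (Srt.obj τ)) := inferInstanceAs (Countable (Option _))
instance (τ : S.Ty) : DiscreteMeasurableSpace (S.Val (Srt.obj τ)) := ⟨fun _ => trivial⟩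

/-! ### Expressions and statements -/

/-- Expressions with free logical variables `x_0, …, x_{n-1}` of the types `Γ 0, …, Γ (n-1)`
(de Bruijn style: a binder adds a new variable `0`). Expressions of sort `prop` are the
first-order formulas. -/
inductive Expr (S : Vocab) : (n : ℕ) → (Fin n → S.Ty) → S.Srt → Type
  /-- a logical variable -/
  | var {n : ℕ} {Γ : Fin n → S.Ty} (i : Fin n) : Expr S n Γ (Srt.obj (Γ i))
  /-- a distinct constant -/
  | con {n : ℕ} {Γ : Fin n → S.Ty} {τ : S.Ty} (c : S.Const τ) : Expr S n Γ (Srt.obj τ)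
  /-- application of a random or fixed function symbol -/
  | app {n : ℕ} {Γ : Fin n → S.Ty} (f : S.Fn)
      (e : ∀ j : Fin (S.fnArity f), Expr S n Γ (Srt.obj (S.fnArg f j))) :
      Expr S n Γ (.ty (S.fnRet f))
  /-- application of an origin function -/
  | org {n : ℕ} {Γ : Fin n → S.Ty} (g : S.Org) (e : Expr S n Γ (Srt.obj (S.orgDom g))) :
      Expr S n Γ (Srt.obj (S.orgCod g))
  /-- a built-in deterministic (measurable) operation or relation on values, such as `+`, `<`,
  literals (no arguments), the predecessor of a time step, or the cardinality of a set -/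
  | op {n : ℕ} {Γ : Fin n → S.Ty} {k : ℕ} {s : Fin k → S.Srt} {r : S.Srt}
      (h : (∀ j, S.Val (s j)) → S.Val r) (hm : Measurable h) (e : ∀ j, Expr S n Γ (s j)) :
      Expr S n Γ r
  /-- equality of elements -/
  | eq {n : ℕ} {Γ : Fin n → S.Ty} {τ : S.Ty} (a b : Expr S n Γ (Srt.obj τ)) : Expr S n Γ .prop
  | not {n : ℕ} {Γ : Fin n → S.Ty} (φ : Expr S n Γ .prop) : Expr S n Γ .prop
  | and {n : ℕ} {Γ : Fin n → S.Ty} (φ ψ : Expr S n Γ .prop) : Expr S n Γ .prop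
  /-- `∀ z : τ, φ`, where `z` ranges over the objects of type `τ` that exist -/
  | all {n : ℕ} {Γ : Fin n → S.Ty} (τ : S.Ty)
      (φ : Expr S (n + 1) (Fin.cons τ Γ : Fin (n + 1) → S.Ty) .prop) : Expr S n Γ .prop
  /-- `∃ z : τ, φ`, where `z` ranges over the objects of type `τ` that exist -/
  | ex {n : ℕ} {Γ : Fin n → S.Ty} (τ : S.Ty)
      (φ : Expr S (n + 1) (Fin.cons τ Γ : Fin (n + 1) → S.Ty) .prop) : Expr S n Γ .prop
  /-- the set `{z for τ z : φ}` of the objects of type `τ` that exist and satisfy `φ` -/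
  | setOf {n : ℕ} {Γ : Fin n → S.Ty} (τ : S.Ty)
      (φ : Expr S (n + 1) (Fin.cons τ Γ : Fin (n + 1) → S.Ty) .prop) : Expr S n Γ (.set τ)

/-- The right-hand side of a dependency or number statement with values in `R`. -/
inductive Stmt (S : Vocab) (n : ℕ) (Γ : Fin n → S.Ty) (R : Type) [MeasurableSpace R] : Type
  /-- `c(e₁, …, e_k)`, where the distribution `c` specifies the probability kernel `κ` -/
  | dist {k : ℕ} {s : Fin k → S.Srt} (κ : Kernel (∀ j, S.Val (s j)) R) (hκ : IsMarkovKernel κ)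
      (e : ∀ j, Expr S n Γ (s j)) : Stmt S n Γ R
  /-- `Mix({D_1 → w_1(e), …, D_m → w_m(e)})`, with weights that sum to `1` for all values of `e` -/
  | mix {m k : ℕ} {s : Fin k → S.Srt} (w : Fin m → (∀ j, S.Val (s j)) → ℝ≥0)
      (hw : ∀ i, Measurable (w i)) (hsum : ∀ x, ∑ i, w i x = 1)
      (e : ∀ j, Expr S n Γ (s j)) (D : Fin m → Stmt S n Γ R) : Stmt S n Γ R
  /-- `if φ then D₁ else D₂` -/
  | ite (φ : Expr S n Γ .prop) (D₁ D₂ : Stmt S n Γ R) : Stmt S n Γ R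

end Vocab

/-- How a function symbol is declared: `random`, with a dependency statement whose free variables
are the arguments of the function, or `fixed`, with an interpretation. -/
inductive Decl (S : Vocab) (f : S.Fn) : Type
  | random (s : S.Stmt (S.fnArity f) (S.fnArg f) (S.TVal (S.fnRet f)))
  | fixed (F : (∀ j, S.Elem (S.fnArg f j)) → S.TVal (S.fnRet f))

/-- A measure-theoretic BLOG model (observations and queries play no role in its prior). -/
structure Model extends Vocab where
  decl : ∀ f, Decl toVocab f
  numStmt : ∀ ν, toVocab.Stmt (toVocab.numArity ν) (toVocab.numArg ν) ℕ

/-! ### Basic random variables -/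

/-- The basic random variables: number variables `V_ν[u]`, and function application variables
`V_f[u]` for random, fixed and origin functions. -/
inductive BRV (S : Vocab) : Type
  | num (ν : S.Num) (u : ∀ j, S.Elem (S.numArg ν j))
  | fn (f : S.Fn) (u : ∀ j, S.Elem (S.fnArg f j))
  | org (g : S.Org) (u : S.Elem (S.orgDom g))

namespace BRV

variable {S : Vocab}

/-- The space of a basic random variable. -/
def Space : BRV S → Type
  | .num _ _ => ℕ
  | .fn f _ => S.TVal (S.fnRet f)
  | .org g _ => S.TVal (.inl (S.orgCod g))

instance : ∀ v : BRV S, MeasurableSpace v.Space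
  | .num _ _ => inferInstanceAs (MeasurableSpace ℕ)
  | .fn f _ => inferInstanceAs (MeasurableSpace (S.TVal (S.fnRet f)))
  | .org g _ => inferInstanceAs (MeasurableSpace (S.TVal (.inl (S.orgCod g))))

/-- The value that says that nothing is there: `0` for number variables, `null` for the others. -/
def default : ∀ v : BRV S, v.Space
  | .num _ _ => (0 : ℕ)
  | .fn f _ => S.null (S.fnRet f)
  | .org g _ => S.null (.inl (S.orgCod g))

end BRV

/-- Instantiations of all basic random variables. -/
abbrev Inst (S : Vocab) : Type := ∀ v : BRV S, v.Space

namespace Vocab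

variable {S : Vocab}

/-- The number variables on which the existence of an element depends: the variable `V_ν[u]` for
the element `gen ν u i`, none for a constant. -/
def Elem.numVars : ∀ {τ : S.Ty}, S.Elem τ → Set (BRV S)
  | _, .con _ => ∅
  | _, .gen ν u _ => {.num ν u}

/-- Whether an element exists under `σ`: `gen ν u i` does if `σ (V_ν[u]) ≥ i + 1`. -/
def Elem.Exists (σ : Inst S) : ∀ {τ : S.Ty}, S.Elem τ → Prop
  | _, .con _ => True
  | _, .gen ν u i => i < (σ (.num ν u) : ℕ)

/-- Extension of an assignment of elements to logical variables. -/
def push {n : ℕ} {Γ : Fin n → S.Ty} {τ : S.Ty} (z : S.Elem τ) (ρ : ∀ i, S.Elem (Γ i)) :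
    ∀ i, S.Elem ((Fin.cons τ Γ : Fin (n + 1) → S.Ty) i) :=
  Fin.cons (α := fun i => S.Elem ((Fin.cons τ Γ : Fin (n + 1) → S.Ty) i)) z ρ

open Classical in
/-- Value of a function on arguments that may be `null`; the result is `null` if one of them is. -/
noncomputable def strict {k : ℕ} {τ : Fin k → S.Ty} {t : S.Ty ⊕ S.BTy}
    (F : (∀ j, S.Elem (τ j)) → S.TVal t) (x : ∀ j, S.Val (Srt.obj (τ j))) : S.TVal t :=
  if h : ∃ w : ∀ j, S.Elem (τ j), ∀ j, x j = some (w j) then F h.choose else S.null t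

/-- The value of an expression in terms of the values `σ` of the basic random variables, with the
elements `ρ` substituted for the free variables. -/
noncomputable def Expr.eval (σ : Inst S) :
    ∀ {n : ℕ} {Γ : Fin n → S.Ty} {s : S.Srt}, S.Expr n Γ s → (∀ i, S.Elem (Γ i)) → S.Val s
  | _, _, _, .var i, ρ => some (ρ i)
  | _, _, _, .con c, _ => some (Elem.con c)
  | _, _, _, .app f e, ρ => strict (fun w => σ (.fn f w)) fun j => (e j).eval σ ρ
  | _, _, _, .org g e, ρ =>
    strict (k := 1) (τ := fun _ => S.orgDom g) (t := .inl (S.orgCod g))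
      (fun w => σ (.org g (w 0))) fun _ => e.eval σ ρ
  | _, _, _, .op h _ e, ρ => h fun j => (e j).eval σ ρ
  | _, _, _, .eq a b, ρ => a.eval σ ρ = b.eval σ ρ
  | _, _, _, .not φ, ρ => ¬ (φ.eval σ ρ : Prop)
  | _, _, _, .and φ ψ, ρ => (φ.eval σ ρ : Prop) ∧ (ψ.eval σ ρ : Prop)
  | _, _, _, .all τ φ, ρ =>
    ∀ z : S.Elem τ, z.Exists σ → (φ.eval σ (push z ρ) : Prop)
  | _, _, _, .ex τ φ, ρ =>
    ∃ z : S.Elem τ, z.Exists σ ∧ (φ.eval σ (push z ρ) : Prop)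
  | _, _, _, .setOf τ φ, ρ =>
    {z : S.Elem τ | z.Exists σ ∧ (φ.eval σ (push z ρ) : Prop)}

theorem Elem.measurable_exists {τ : S.Ty} (z : S.Elem τ) :
    Measurable fun σ : Inst S => z.Exists σ := by
  cases z with
  | con c => exact measurable_const
  | gen ν u i =>
    have h : Measurable fun σ : Inst S => (σ (.num ν u) : ℕ) :=
      measurable_pi_apply (BRV.num ν u)
    exact (measurable_from_top (f := fun m : ℕ => i < m)).comp h

theorem measurable_strict {k : ℕ} {τ : Fin k → S.Ty} {t : S.Ty ⊕ S.BTy}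
    {F : Inst S → (∀ j, S.Elem (τ j)) → S.TVal t} (hF : ∀ w, Measurable fun σ => F σ w)
    {x : Inst S → ∀ j, S.Val (Srt.obj (τ j))} (hx : ∀ j, Measurable fun σ => x σ j) :
    Measurable fun σ => strict (F σ) (x σ) := by
  have h : Measurable fun p : Inst S × (∀ j, S.Val (Srt.obj (τ j))) => strict (F p.1) p.2 := by
    apply measurable_from_prod_countable_left
    intro y
    unfold strict
    by_cases h : ∃ w : ∀ j, S.Elem (τ j), ∀ j, y j = some (w j)
    · simpa only [dif_pos h] using hF _
    · simpa only [dif_neg h] using measurable_const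
  exact h.comp (measurable_id.prodMk (measurable_pi_lambda _ hx))

theorem Expr.measurable_eval {n : ℕ} {Γ : Fin n → S.Ty} {s : S.Srt} (e : S.Expr n Γ s)
    (ρ : ∀ i, S.Elem (Γ i)) : Measurable fun σ : Inst S => e.eval σ ρ := by
  induction e with
  | var i => exact measurable_const
  | con c => exact measurable_const
  | app f e ih => exact measurable_strict (fun w => measurable_pi_apply _) fun j => ih j ρ
  | org g e ih => exact measurable_strict (fun w => measurable_pi_apply _) fun _ => ih ρ
  | op h hm e ih => exact hm.comp (measurable_pi_lambda _ fun j => ih j ρ)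
  | @eq n Γ τ a b iha ihb =>
    exact (measurable_of_countable
      (fun p : S.Val (Srt.obj τ) × S.Val (Srt.obj τ) => p.1 = p.2)).comp
      ((iha ρ).prodMk (ihb ρ))
  | not φ ih => exact Measurable.not (ih ρ)
  | and φ ψ ihφ ihψ => exact Measurable.and (ihφ ρ) (ihψ ρ)
  | all τ φ ih => exact Measurable.forall fun z => z.measurable_exists.imp (ih _)
  | ex τ φ ih => exact Measurable.exists fun z => z.measurable_exists.and (ih _)
  | setOf τ φ ih => exact measurable_pi_lambda _ fun z => z.measurable_exists.and (ih _)

open Classical in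
/-- The kernel of a statement, from the values of the basic random variables, after substitution
of the elements `ρ` for the free variables. -/
noncomputable def Stmt.kernel {n : ℕ} {Γ : Fin n → S.Ty} {R : Type} [MeasurableSpace R]
    (ρ : ∀ i, S.Elem (Γ i)) : S.Stmt n Γ R → Kernel (Inst S) R
  | .dist κ _ e =>
    κ.comap (fun σ j => (e j).eval σ ρ) (measurable_pi_lambda _ fun j => (e j).measurable_eval ρ)
  | .mix w hw _ e D =>
    { toFun := fun σ => ∑ i, (w i fun j => (e j).eval σ ρ) • (D i).kernel ρ σ
      measurable' := by
        refine Measure.measurable_of_measurable_coe _ fun A hA => ?_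
        simp only [Measure.coe_finsetSum, Measure.coe_nnreal_smul_apply, Finset.sum_apply]
        refine Finset.measurable_sum _ fun i _ => Measurable.mul ?_ ?_
        · exact measurable_coe_nnreal_ennreal.comp ((hw i).comp
            (measurable_pi_lambda _ fun j => (e j).measurable_eval ρ))
        · exact ((D i).kernel ρ).measurable_coe hA }
  | .ite φ D₁ D₂ =>
    Kernel.piecewise (s := {σ | φ.eval σ ρ}) (measurableSet_setOfPred.2 (φ.measurable_eval ρ))
      (D₁.kernel ρ) (D₂.kernel ρ)

theorem Stmt.isMarkovKernel {n : ℕ} {Γ : Fin n → S.Ty} {R : Type} [MeasurableSpace R]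
    (ρ : ∀ i, S.Elem (Γ i)) (D : S.Stmt n Γ R) : IsMarkovKernel (D.kernel ρ) := by
  induction D with
  | dist κ hκ e => unfold Stmt.kernel; infer_instance
  | mix w hw hsum e D ih =>
    refine ⟨fun σ => ⟨?_⟩⟩
    change (∑ i, (w i fun j => (e j).eval σ ρ) • (D i).kernel ρ σ) Set.univ = 1
    simp only [Measure.coe_finsetSum, Measure.coe_nnreal_smul_apply, Finset.sum_apply,
      measure_univ, mul_one]
    rw [← ENNReal.ofNNReal_finsetSum, hsum, ENNReal.coe_one]
  | ite φ D₁ D₂ ih₁ ih₂ => unfold Stmt.kernel; infer_instance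

end Vocab

/-! ### Edges -/

namespace Model

variable (M : Model)

open Vocab

/-- The values that an expression can take once the elements `ρ` are substituted for its free
variables, as far as they are determined independently of the random functions: a variable, a
constant, and whatever is computed from these by built-in, fixed or origin functions (which also
may be `null`) have a known value. -/
def poss : ∀ {n : ℕ} {Γ : Fin n → M.Ty} {s : M.Srt},
    M.Expr n Γ s → (∀ i, M.Elem (Γ i)) → Set (M.Val s)
  | _, _, _, .var i, ρ => {y | y = some (ρ i)}
  | _, _, _, .con c, _ => {y | y = some (Elem.con c)}
  | _, _, _, .app f e, ρ =>
    match M.decl f with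
    | .random _ => Set.univ
    | .fixed F => {y | y = M.null _ ∨
        ∃ w : ∀ j, M.Elem (M.fnArg f j), (∀ j, some (w j) ∈ poss (e j) ρ) ∧ y = F w}
  | _, _, _, .org g e, ρ =>
    {y | y = none ∨ ∃ w : M.Elem (M.orgDom g), some w ∈ poss e ρ ∧ y = w.origin g}
  | _, _, _, .op h _ e, ρ => {y | ∃ x, (∀ j, x j ∈ poss (e j) ρ) ∧ y = h x}
  | _, _, _, _, _ => Set.univ

/-- The basic random variables that determine the value of an expression, with the elements `ρ`
substituted for the free variables. The application `g(e₁, …, e_k)` contributes the variables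
`V_g[w]` for all possible values `w` of the arguments; when these are logical variables, `w` is
the tuple of the elements substituted for them. For a bound variable, every element of its type is
substituted; the number variables that decide whether that element exists are included. -/
def deps : ∀ {n : ℕ} {Γ : Fin n → M.Ty} {s : M.Srt},
    M.Expr n Γ s → (∀ i, M.Elem (Γ i)) → Set (BRV M.toVocab)
  | _, _, _, .var _, _ => ∅
  | _, _, _, .con _, _ => ∅
  | _, _, _, .app f e, ρ =>
    {v | ∃ w, (∀ j, some (w j) ∈ M.poss (e j) ρ) ∧ v = .fn f w} ∪ ⋃ j, deps (e j) ρ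
  | _, _, _, .org g e, ρ => {v | ∃ w, some w ∈ poss M e ρ ∧ v = .org g w} ∪ deps e ρ
  | _, _, _, .op _ _ e, ρ => ⋃ j, deps (e j) ρ
  | _, _, _, .eq a b, ρ => deps a ρ ∪ deps b ρ
  | _, _, _, .not φ, ρ => deps φ ρ
  | _, _, _, .and φ ψ, ρ => deps φ ρ ∪ deps ψ ρ
  | _, _, _, .all τ φ, ρ => ⋃ z : M.Elem τ, z.numVars ∪ deps φ (push z ρ)
  | _, _, _, .ex τ φ, ρ => ⋃ z : M.Elem τ, z.numVars ∪ deps φ (push z ρ)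
  | _, _, _, .setOf τ φ, ρ => ⋃ z : M.Elem τ, z.numVars ∪ deps φ (push z ρ)

/-- The basic random variables that determine the values of the expressions in a statement. -/
def stmtDeps {n : ℕ} {Γ : Fin n → M.Ty} {R : Type} [MeasurableSpace R] (ρ : ∀ i, M.Elem (Γ i)) :
    M.Stmt n Γ R → Set (BRV M.toVocab)
  | .dist _ _ e => ⋃ j, M.deps (e j) ρ
  | .mix _ _ _ e D => (⋃ j, M.deps (e j) ρ) ∪ ⋃ i, stmtDeps ρ (D i)
  | .ite φ D₁ D₂ => M.deps φ ρ ∪ stmtDeps ρ D₁ ∪ stmtDeps ρ D₂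

/-- The basic random variables that determine the values of the expressions in the declaration of
a function symbol. -/
def declDeps {f : M.Fn} (u : ∀ j, M.Elem (M.fnArg f j)) :
    Decl M.toVocab f → Set (BRV M.toVocab)
  | .random s => M.stmtDeps u s
  | .fixed _ => ∅

/-- The parents of a basic random variable `V_s[u]`: the number variables of the elements in `u`,
and the variables that determine the expressions in the statement of `s`. -/
def parents : BRV M.toVocab → Set (BRV M.toVocab)
  | .num ν u => (⋃ j, (u j).numVars) ∪ M.stmtDeps u (M.numStmt ν)
  | .fn f u => (⋃ j, (u j).numVars) ∪ M.declDeps u (M.decl f)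
  | .org _ u => u.numVars

/-- The edges `v → w` between basic random variables. -/
def Edge (v w : BRV M.toVocab) : Prop := v ∈ M.parents w

/-! ### Kernels -/

/-- All elements in the index of a basic random variable exist under `σ`. -/
def ArgsExist (σ : Inst M.toVocab) : BRV M.toVocab → Prop
  | .num _ u => ∀ j, (u j).Exists σ
  | .fn _ u => ∀ j, (u j).Exists σ
  | .org _ u => u.Exists σ

theorem measurable_argsExist (v : BRV M.toVocab) :
    Measurable fun σ : Inst M.toVocab => M.ArgsExist σ v := by
  cases v with
  | num ν u => exact Measurable.forall fun j => (u j).measurable_exists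
  | fn f u => exact Measurable.forall fun j => (u j).measurable_exists
  | org g u => exact u.measurable_exists

/-- The kernel of the declaration of a function symbol; a fixed function takes the value of its
interpretation. -/
noncomputable def declKernel {S : Vocab} {f : S.Fn} (u : ∀ j, S.Elem (S.fnArg f j)) :
    Decl S f → Kernel (Inst S) (S.TVal (S.fnRet f))
  | .random s => s.kernel u
  | .fixed F => Kernel.const _ (Measure.dirac (F u))

/-- The kernel of the statement of a basic random variable, in terms of all basic random variables
and without regard to the existence of the arguments. Origin functions are the inverse maps of the generation of objects. -/
noncomputable def bodyKernel : ∀ v : BRV M.toVocab, Kernel (Inst M.toVocab) v.Space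
  | .num ν u => (M.numStmt ν).kernel u
  | .fn f u => declKernel u (M.decl f)
  | .org g u => Kernel.const _ (Measure.dirac (u.origin g : M.TVal (.inl (M.orgCod g))))

theorem isMarkovKernel_bodyKernel (v : BRV M.toVocab) : IsMarkovKernel (M.bodyKernel v) := by
  have hdirac {R : Type} [MeasurableSpace R] (r : R) :
      IsMarkovKernel (Kernel.const (Inst M.toVocab) (Measure.dirac r)) := inferInstance
  cases v with
  | num ν u => exact Stmt.isMarkovKernel u _
  | fn f u =>
    change IsMarkovKernel (declKernel u (M.decl f))
    cases M.decl f with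
    | random s => exact s.isMarkovKernel u
    | fixed F => exact hdirac (R := M.TVal _) _
  | org g u => exact hdirac (R := M.TVal (.inl (M.orgCod g))) _

open Classical in
/-- The locally consistent kernel of a basic random variable in terms of all basic random
variables: if an element of its index does not exist, the value is `null` (`0` for a number
variable). -/
noncomputable def fullKernel (v : BRV M.toVocab) : Kernel (Inst M.toVocab) v.Space :=
  Kernel.piecewise (s := {σ | M.ArgsExist σ v})
    (measurableSet_setOfPred.2 (M.measurable_argsExist v))
    (M.bodyKernel v) (Kernel.const _ (Measure.dirac v.default))

open Classical in
/-- The instantiation that agrees with `x` on the parents of `v` and has default values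
elsewhere. -/
noncomputable def fill (v : BRV M.toVocab) (x : ∀ u : {u // M.Edge u v}, u.1.Space) :
    Inst M.toVocab :=
  fun u => if h : M.Edge u v then x ⟨u, h⟩ else u.default

theorem measurable_fill (v : BRV M.toVocab) : Measurable (M.fill v) := by
  refine measurable_pi_lambda _ fun u => ?_
  by_cases h : M.Edge u v
  · simpa [fill, h] using measurable_pi_apply (⟨u, h⟩ : {u // M.Edge u v})
  · simp [fill, h]

/-- The kernel of a basic random variable from its parents: the kernel of its statement, read as a
function of the values of the parents. (The default values in `fill` are never looked up when the
fixed and origin functions among the parents have their prescribed values or `null`, which holds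
almost surely.) -/
noncomputable def paKernel (v : BRV M.toVocab) :
    Kernel (∀ u : {u // M.Edge u v}, u.1.Space) v.Space :=
  (M.fullKernel v).comap (M.fill v) (M.measurable_fill v)

theorem isMarkovKernel_paKernel (v : BRV M.toVocab) : IsMarkovKernel (M.paKernel v) := by
  have := M.isMarkovKernel_bodyKernel v
  unfold paKernel fullKernel
  infer_instance

/-- The MTBN of a BLOG model with a well-founded graph. -/
noncomputable def toMTBN (h : WellFoundedDigraph M.Edge) : MTBN (BRV M.toVocab) where
  Edge := M.Edge
  wellFounded := h
  X := BRV.Space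
  K := M.paKernel
  markov := M.isMarkovKernel_paKernel

end Model

end BLOG

/-! ## Measures on products, compared on cylinder events -/

section Trim

variable {Ω : Type*} {m mΩ : MeasurableSpace Ω} {μ ν : Measure Ω}

/-! The result holds for every MTBN with a nonempty product space; of the BLOG kernels only the
Markov property and the dependence on parents alone matter. Extend the edge relation to a well-order
of the vertices and sample the coordinates in that order, each from its kernel.

The spaces are arbitrary, so no topological extension theorem applies. The sampling is built by
transfinite induction (`exists_isResamplingKernel`). A single coordinate is added by composing
kernels. If a sequence is cofinal, the limit is an Ionescu-Tulcea Markov chain that samples a whole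
block of coordinates per time step. If all sequences are bounded, every event already belongs to an
earlier stage, and the consistent earlier measures glue. Blocks are differences of initial segments,
so the induction covers arbitrary sets of resampled coordinates, the others keeping given values.

Uniqueness: a finite box is peeled at its last coordinate, so the conditional laws given the past
determine the measure (`measure_eq_on_cylinderEvents`).

The construction controls `X_v` only given earlier coordinates, but non-descendants may come later.
`IsResampling.measure_inter_eq_setLIntegral` adds these one by one: the kernels of `v` and of a
later non-descendant enter as commuting factors. The resulting property `MTBN.Factorizes` is
equivalent to `MTBN.Represents`. -/

theorem lintegral_congr_of_measure_eq_on (hm : m ≤ mΩ)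
    (h : ∀ C, MeasurableSet[m] C → μ C = ν C) {f : Ω → ℝ≥0∞} (hf : Measurable[m] f) :
    ∫⁻ x, f x ∂μ = ∫⁻ x, f x ∂ν := by
  have : μ.trim hm = ν.trim hm := by
    refine @Measure.ext _ m _ _ fun C hC => ?_
    rw [trim_measurableSet_eq hm hC, trim_measurableSet_eq hm hC, h C hC]
  rw [← lintegral_trim hm hf, this, lintegral_trim hm hf]

theorem setLIntegral_congr_of_measure_eq_on (hm : m ≤ mΩ)
    (h : ∀ C, MeasurableSet[m] C → μ C = ν C) {f : Ω → ℝ≥0∞} (hf : Measurable[m] f)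
    {C : Set Ω} (hC : MeasurableSet[m] C) :
    ∫⁻ x in C, f x ∂μ = ∫⁻ x in C, f x ∂ν := by
  rw [← lintegral_indicator (hm C hC), ← lintegral_indicator (hm C hC)]
  exact lintegral_congr_of_measure_eq_on hm h (hf.indicator hC)

end Trim

/-! ### Cylinder σ-algebras, and uniqueness along a well-order -/

section Cylinders

variable {V : Type*} {X : V → Type*} [∀ v, MeasurableSpace (X v)]

theorem measurableSet_eval_preimage {S : Set V} {v : V} (hv : v ∈ S) {B : Set (X v)}
    (hB : MeasurableSet B) :
    MeasurableSet[cylinderEvents S] ((fun x : ∀ v, X v => x v) ⁻¹' B) :=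
  measurable_cylinderEvent_apply hv hB

theorem MeasurableSet.of_cylinderEvents {S : Set V} {C : Set (∀ v, X v)}
    (hC : MeasurableSet[cylinderEvents S] C) : MeasurableSet C :=
  cylinderEvents_le_pi _ hC

theorem cylinderEvents_eq_comap (S : Set V) :
    cylinderEvents (X := X) S =
      MeasurableSpace.comap (fun x (u : S) => x u.1) inferInstance := by
  rw [cylinderEvents, MeasurableSpace.pi, MeasurableSpace.comap_iSup, iSup_subtype']
  simp only [MeasurableSpace.comap_comp]
  rfl

theorem mem_congr_of_cylinderEvents {S : Set V} {C : Set (∀ v, X v)}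
    (hC : MeasurableSet[cylinderEvents S] C) {x y : ∀ v, X v} (h : ∀ v ∈ S, x v = y v) :
    x ∈ C ↔ y ∈ C := by
  rw [cylinderEvents_eq_comap] at hC
  obtain ⟨D, -, rfl⟩ := hC
  have : (fun u : S => x u.1) = fun u : S => y u.1 := funext fun u => h u u.2
  simp only [Set.mem_preimage, this]

theorem eq_of_measurable_cylinderEvents {S : Set V} {f : (∀ v, X v) → ℝ≥0∞}
    (hf : Measurable[cylinderEvents S] f) {x y : ∀ v, X v} (h : ∀ v ∈ S, x v = y v) :
    f x = f y :=
  ((mem_congr_of_cylinderEvents (hf (measurableSet_singleton (f y))) h).2 rfl :)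

/-- Finite boxes form a generating π-system. The largest index of a box splits off one coordinate,
over an event of strictly earlier ones, so transfinite induction applies. -/
theorem measure_eq_on_cylinderEvents [LinearOrder V] [WellFoundedLT V]
    {μ ν : Measure (∀ v, X v)} [IsFiniteMeasure μ] (huniv : μ Set.univ = ν Set.univ) {S : Set V}
    (hmax : ∀ s ∈ S,
      (∀ C, MeasurableSet[cylinderEvents (S ∩ Set.Iio s)] C → μ C = ν C) →
      ∀ C, MeasurableSet[cylinderEvents (S ∩ Set.Iio s)] C → ∀ B : Set (X s), MeasurableSet B →
        μ (C ∩ (fun x => x s) ⁻¹' B) = ν (C ∩ (fun x => x s) ⁻¹' B))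
    {C : Set (∀ v, X v)} (hC : MeasurableSet[cylinderEvents S] C) : μ C = ν C := by
  -- Used for initial segments `T` of `S`: first the proper ones `S ∩ Set.Iio s`, then `S` itself.
  have step : ∀ T ⊆ S,
      (∀ s ∈ T, T ∩ Set.Iio s = S ∩ Set.Iio s ∧
        ∀ C, MeasurableSet[cylinderEvents (S ∩ Set.Iio s)] C → μ C = ν C) →
      ∀ C, MeasurableSet[cylinderEvents T] C → μ C = ν C := by
    intro T hTS hT C hC
    refine ext_on_measurableSpace_of_generate_finite _ _ ?_ cylinderEvents_le_pi
      (generateFrom_piiUnionInter_measurableSet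
        (fun v => (inferInstance : MeasurableSpace (X v)).comap fun x : ∀ v, X v => x v) T).symm
      (isPiSystem_piiUnionInter _ (fun v => @MeasurableSpace.isPiSystem_measurableSet _ (_)) _)
      huniv hC
    rintro _ ⟨t, htT, f, hf, rfl⟩
    rcases t.eq_empty_or_nonempty with rfl | hne
    · simpa using huniv
    set s := t.max' hne with hs
    have hst : s ∈ t := t.max'_mem hne
    obtain ⟨hTs, heq⟩ := hT s (htT hst)
    obtain ⟨B, hB, hBf⟩ := hf s hst
    have : (⋂ v ∈ t, f v) = (⋂ v ∈ t.erase s, f v) ∩ (fun x => x s) ⁻¹' B := by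
      conv_lhs => rw [← Finset.insert_erase hst]
      rw [Finset.set_biInter_insert, Set.inter_comm, ← hBf]
    rw [this]
    refine hmax s (hTS (htT hst)) heq _ ?_ B hB
    rw [← hTs]
    refine Finset.measurableSet_biInter _ fun v hv => ?_
    rw [Finset.mem_erase] at hv
    obtain ⟨B', hB', hBf'⟩ := hf v hv.2
    rw [← hBf']
    have hvs : v ∈ T ∩ Set.Iio s := ⟨htT hv.2, lt_of_le_of_ne (t.le_max' v hv.2) hv.1⟩
    exact measurableSet_eval_preimage hvs hB'
  have main : ∀ s : V, ∀ C, MeasurableSet[cylinderEvents (S ∩ Set.Iio s)] C → μ C = ν C := by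
    intro s
    induction s using WellFoundedLT.induction with
    | _ s ih =>
      refine step _ Set.inter_subset_left fun r hr => ⟨?_, ih r hr.2⟩
      rw [Set.inter_assoc, Set.Iio_inter_Iio, min_eq_right (le_of_lt hr.2)]
  exact step S subset_rfl (fun s _ => ⟨rfl, main s⟩) C hC

end Cylinders

/-! ### Markov chains from the Ionescu-Tulcea theorem -/

section MarkovChain

open Kernel Finset Preorder

/-- An inhomogeneous Markov chain on a constant state space, started at a point. -/
theorem exists_markovChain {E : Type*} [MeasurableSpace E] (Q : ℕ → Kernel E E)
    [∀ n, IsMarkovKernel (Q n)] :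
    ∃ T : Kernel E (ℕ → E), IsMarkovKernel T ∧
      (∀ x, (T x).map (fun ω => ω 0) = Measure.dirac x) ∧
      ∀ x n C D, MeasurableSet C → MeasurableSet D →
        T x {ω | ω n ∈ C ∧ ω (n + 1) ∈ D} = ∫⁻ y in C, Q n y D ∂(T x).map (fun ω => ω n) := by
  let κ : (n : ℕ) → Kernel (Π _ : Iic n, E) E := fun n =>
    (Q n).comap (fun z => z ⟨n, mem_Iic.2 le_rfl⟩) (measurable_pi_apply _)
  have hκ : ∀ n, IsMarkovKernel (κ n) := fun n => by dsimp only [κ]; infer_instance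
  let st : E → (Π _ : Iic 0, E) := fun x _ => x
  have hst : Measurable st := measurable_pi_lambda _ fun _ => measurable_id
  refine ⟨(traj (X := fun _ => E) κ 0).comap st hst, inferInstance, fun x => ?_,
    fun x n C D hC hD => ?_⟩
  · rw [Kernel.comap_apply]
    have hev : Measurable fun z : Π _ : Iic 0, E => z ⟨0, mem_Iic.2 le_rfl⟩ :=
      measurable_pi_apply _
    have h := traj_map_frestrictLe_apply (X := fun _ => E) (κ := κ) 0 0 (st x)
    rw [partialTraj_self, Kernel.id_apply] at h
    have h2 := congrArg (Measure.map fun z : Π _ : Iic 0, E => z ⟨0, mem_Iic.2 le_rfl⟩) h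
    rw [Measure.map_map hev (measurable_frestrictLe _), Measure.map_dirac' hev] at h2
    exact h2
  · rw [Kernel.comap_apply]
    have h := partialTraj_compProd_eq_map_traj (X := fun _ => E) (κ := κ) (Nat.zero_le n)
      (x₀ := st x)
    rw [← traj_map_frestrictLe_apply] at h
    have hCz : MeasurableSet {z : Π _ : Iic n, E | z ⟨n, mem_Iic.2 le_rfl⟩ ∈ C} :=
      (measurable_pi_apply (⟨n, mem_Iic.2 le_rfl⟩ : Iic n)) hC
    have h2 := congrArg
      (fun ρ => ρ ({z : Π _ : Iic n, E | z ⟨n, mem_Iic.2 le_rfl⟩ ∈ C} ×ˢ D)) h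
    beta_reduce at h2
    rw [Measure.compProd_apply_prod hCz hD, Measure.map_apply (by fun_prop) (hCz.prod hD)] at h2
    refine Eq.trans ?_ (h2.symm.trans ?_)
    · rfl
    · rw [Measure.restrict_map (measurable_frestrictLe n) hCz,
        lintegral_map (Kernel.measurable_coe _ hD) (measurable_frestrictLe n),
        Measure.restrict_map (measurable_pi_apply n) hC,
        lintegral_map (Kernel.measurable_coe _ hD) (measurable_pi_apply n)]
      rfl

end MarkovChain

/-! ## Resampling along a well-order -/

section Resampling

variable {V : Type*} [LinearOrder V] {X : V → Type*} [∀ v, MeasurableSpace (X v)]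

/-- `ν` is a law of the random point that arises from `x` when the coordinates in `I` are
resampled, in increasing order, according to the kernels `K`, and the others are kept. -/
structure IsResampling (K : ∀ v, Kernel (∀ v, X v) (X v)) (I : Set V) (x : ∀ v, X v)
    (ν : Measure (∀ v, X v)) : Prop where
  prob : IsProbabilityMeasure ν
  fixed : ∀ v ∉ I, ∀ B : Set (X v), MeasurableSet B → x v ∈ B → ∀ᵐ y ∂ν, y v ∈ B
  step : ∀ v ∈ I, ∀ C, MeasurableSet[cylinderEvents (Set.Iio v)] C → ∀ B : Set (X v),
    MeasurableSet B → ν (C ∩ (fun y => y v) ⁻¹' B) = ∫⁻ y in C, K v y B ∂ν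

/-- The kernels depend only on the earlier coordinates. -/
def DependsOnPast (K : ∀ v, Kernel (∀ v, X v) (X v)) : Prop :=
  ∀ v (B : Set (X v)), MeasurableSet B →
    Measurable[cylinderEvents (Set.Iio v)] fun y => K v y B

variable {K : ∀ v, Kernel (∀ v, X v) (X v)} {I I' J S : Set V} {x : ∀ v, X v}
  {ν ν' : Measure (∀ v, X v)}

/-- Points need not be measurable, so a kept coordinate is known only event by event; `fixed` is
applied to `B` or to its complement. -/
theorem IsResampling.measure_inter_fixed (h : IsResampling K I x ν) {v : V} (hv : v ∉ I)
    {B : Set (X v)} (hB : MeasurableSet B) (C : Set (∀ v, X v)) :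
    ν (C ∩ (fun y => y v) ⁻¹' B) = Set.indicator B (fun _ => ν C) (x v) := by
  by_cases hx : x v ∈ B
  · rw [Set.indicator_of_mem hx]
    refine measure_congr ?_
    filter_upwards [h.fixed v hv B hB hx] with y hy
    exact propext (and_iff_left hy)
  · rw [Set.indicator_of_notMem hx]
    refine measure_mono_null Set.inter_subset_right ?_
    exact ae_iff.1 (h.fixed v hv Bᶜ hB.compl hx) ▸ congrArg ν (by ext; simp)

theorem isResampling_dirac (x : ∀ v, X v) : IsResampling K ∅ x (Measure.dirac x) where
  prob := inferInstance
  fixed v _ _ hB hx := (ae_dirac_iff (measurable_pi_apply v hB)).2 hx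
  step _ hv := hv.elim

/-- A kept coordinate contributes an indicator at `x`; a resampled one contributes an integral of
its kernel, which sees only the past, where the measures already agree. Hence `I` and `I'` need to
coincide only on `S`. -/
theorem IsResampling.measure_eq [WellFoundedLT V] (hK : DependsOnPast K)
    (h : IsResampling K I x ν) (h' : IsResampling K I' x ν')
    (hS : ∀ s ∈ S, (s ∈ I ↔ s ∈ I') ∧ (s ∈ I → Set.Iio s ⊆ S)) {C : Set (∀ v, X v)}
    (hC : MeasurableSet[cylinderEvents S] C) : ν C = ν' C := by
  have := h.prob
  have := h'.prob
  refine measure_eq_on_cylinderEvents (S := S) (by simp) (fun s hs heq C hC B hB => ?_) hC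
  by_cases hsI : s ∈ I
  · have hle : Set.Iio s ⊆ S ∩ Set.Iio s := Set.subset_inter ((hS s hs).2 hsI) subset_rfl
    have hC' := cylinderEvents_mono (X := X) Set.inter_subset_right _ hC
    rw [h.step s hsI C hC' B hB, h'.step s ((hS s hs).1.1 hsI) C hC' B hB]
    exact setLIntegral_congr_of_measure_eq_on cylinderEvents_le_pi heq
      ((hK s B hB).mono (cylinderEvents_mono hle) le_rfl) hC
  · rw [h.measure_inter_fixed hsI hB, h'.measure_inter_fixed (mt (hS s hs).1.2 hsI) hB, heq C hC]

/-- Each condition involves one coordinate and, if it is resampled, its past. It can therefore be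
borrowed from a different known resampling for each `v`; both limit constructions are verified this
way. -/
theorem IsResampling.of_locally (hK : DependsOnPast K) (hν : IsProbabilityMeasure ν)
    (h : ∀ v, ∃ S I' ν', IsResampling K I' x ν' ∧ v ∈ S ∧ (v ∈ I ↔ v ∈ I') ∧
      (v ∈ I → Set.Iio v ⊆ S) ∧ ∀ C, MeasurableSet[cylinderEvents S] C → ν C = ν' C) :
    IsResampling K I x ν where
  prob := hν
  fixed v hv B hB hx := by
    obtain ⟨S, I', ν', h', hvS, hvI, -, heq⟩ := h v
    have := h'.fixed v (mt hvI.2 hv) B hB hx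
    rw [ae_iff] at this ⊢
    rw [← this]
    exact heq _ (measurableSet_eval_preimage hvS hB.compl)
  step v hv C hC B hB := by
    obtain ⟨S, I', ν', h', hvS, hvI, hlt, heq⟩ := h v
    have hle := cylinderEvents_mono (X := X) (hlt hv)
    rw [heq _ ((hle _ hC).inter (measurableSet_eval_preimage hvS hB)),
      h'.step v (hvI.1 hv) C hC B hB]
    exact (setLIntegral_congr_of_measure_eq_on cylinderEvents_le_pi heq
      ((hK v B hB).mono hle le_rfl) (hle _ hC)).symm

theorem IsResampling.apply_eq_indicator [WellFoundedLT V] (hK : DependsOnPast K)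
    (h : IsResampling K I x ν) {C : Set (∀ v, X v)}
    (hC : MeasurableSet[cylinderEvents Iᶜ] C) : ν C = C.indicator 1 x := by
  rw [← Measure.dirac_apply' x hC.of_cylinderEvents]
  exact h.measure_eq hK (isResampling_dirac x) (S := Iᶜ)
    (fun s hs => ⟨by simpa using hs, fun h => (hs h).elim⟩) hC

/-- A kernel that resamples the coordinates in `I`. -/
def IsResamplingKernel (K : ∀ v, Kernel (∀ v, X v) (X v)) (I : Set V)
    (P : Kernel (∀ v, X v) (∀ v, X v)) : Prop :=
  ∀ x, IsResampling K I x (P x)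

theorem IsResamplingKernel.isMarkovKernel {P : Kernel (∀ v, X v) (∀ v, X v)}
    (h : IsResamplingKernel K I P) : IsMarkovKernel P :=
  ⟨fun x => (h x).prob⟩

/-- `Q` does not disturb events outside `J`, among them the pasts of the coordinates in `I`. For
coordinates in `J`, the identity holds from every starting point and is averaged over `ν`. -/
theorem IsResampling.bind [WellFoundedLT V] (hK : DependsOnPast K) (h : IsResampling K I x ν)
    {Q : Kernel (∀ v, X v) (∀ v, X v)} (hQ : IsResamplingKernel K J Q)
    (hIJ : ∀ i ∈ I, ∀ j ∈ J, i < j) : IsResampling K (I ∪ J) x (ν.bind Q) := by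
  have := h.prob
  have := hQ.isMarkovKernel
  have heq : ∀ C, MeasurableSet[cylinderEvents Jᶜ] C → (ν.bind Q) C = ν C := by
    intro C hC
    rw [Measure.bind_apply hC.of_cylinderEvents Q.aemeasurable]
    simp_rw [fun y => (hQ y).apply_eq_indicator hK hC]
    exact lintegral_indicator_one hC.of_cylinderEvents
  have hp : IsProbabilityMeasure (ν.bind Q) := inferInstance
  refine ⟨hp, fun v hv B hB hx => ?_, fun v hv C hC B hB => ?_⟩
  · have hv' : v ∉ I ∧ v ∉ J := by simpa using hv
    have := h.fixed v hv'.1 B hB hx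
    rw [ae_iff] at this ⊢
    rw [← this]
    exact heq _ (measurableSet_eval_preimage hv'.2 hB.compl)
  · have hCm := hC.of_cylinderEvents
    have hKm : Measurable fun y => K v y B := (hK v B hB).mono cylinderEvents_le_pi le_rfl
    by_cases hvJ : v ∈ J
    · rw [Measure.bind_apply (hCm.inter (measurable_pi_apply v hB)) Q.aemeasurable,
        ← lintegral_indicator hCm, Measure.lintegral_bind Q.aemeasurable
          (hKm.indicator hCm).aemeasurable]
      refine lintegral_congr fun y => ?_
      rw [lintegral_indicator hCm, (hQ y).step v hvJ C hC B hB]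
    · have hvI : v ∈ I := hv.resolve_right hvJ
      have hlt : Set.Iio v ⊆ Jᶜ := fun u hu hj => lt_asymm (hIJ v hvI u hj) hu
      have hle := cylinderEvents_mono (X := X) hlt
      rw [heq _ ((hle _ hC).inter (measurableSet_eval_preimage hvJ hB)), h.step v hvI C hC B hB]
      exact (setLIntegral_congr_of_measure_eq_on cylinderEvents_le_pi heq
        ((hK v B hB).mono hle le_rfl) (hle _ hC)).symm

theorem isResamplingKernel_id : IsResamplingKernel K ∅ Kernel.id := fun x => by
  rw [Kernel.id_apply]
  exact isResampling_dirac x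

theorem exists_isResamplingKernel_singleton [∀ v, IsMarkovKernel (K v)] (hK : DependsOnPast K)
    (w : V) : ∃ P, IsResamplingKernel K {w} P := by
  have hm : Measurable fun p : (∀ v, X v) × X w => Function.update p.1 w p.2 := measurable_update'
  refine ⟨(Kernel.id ×ₖ K w).map fun p => Function.update p.1 w p.2, fun x => ?_⟩
  have hmx : Measurable fun b : X w => Function.update x w b := measurable_update x
  have hP : ((Kernel.id ×ₖ K w).map fun p => Function.update p.1 w p.2) x =
      (K w x).map (Function.update x w) := by
    rw [Kernel.map_apply _ hm, Kernel.prod_apply, Kernel.id_apply, Measure.dirac_prod,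
      Measure.map_map hm (by fun_prop)]
    rfl
  rw [hP]
  have hp : IsProbabilityMeasure ((K w x).map (Function.update x w)) :=
    Measure.isProbabilityMeasure_map hmx.aemeasurable
  have hupd : ∀ b : X w, ∀ v ∈ Set.Iio w, Function.update x w b v = x v := fun b v hv =>
    Function.update_of_ne (ne_of_lt hv) _ _
  refine ⟨hp, fun v hv B hB hx => ?_, ?_⟩
  · rw [ae_map_iff hmx.aemeasurable (measurable_pi_apply v hB)]
    refine Filter.Eventually.of_forall fun b => ?_
    change Function.update x w b v ∈ B
    rwa [Function.update_of_ne (by simpa using hv)]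
  · rintro v hv C hC B hB
    obtain rfl : v = w := hv
    have hKm : Measurable fun y => K v y B := (hK v B hB).mono cylinderEvents_le_pi le_rfl
    have hCm := hC.of_cylinderEvents
    rw [Measure.map_apply hmx (hCm.inter (measurable_pi_apply v hB)),
      ← lintegral_indicator hCm, lintegral_map (hKm.indicator hCm) hmx]
    -- Neither `C` nor the kernel sees coordinate `v`, so the integrand is constant in the new
    -- value.
    have : ∀ b, C.indicator (fun y => K v y B) (Function.update x v b) =
        C.indicator (fun y => K v y B) x := fun b =>
      eq_of_measurable_cylinderEvents ((hK v B hB).indicator hC) (hupd b)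
    simp_rw [this]
    rw [lintegral_const, measure_univ, mul_one]
    by_cases hx : x ∈ C
    · rw [Set.indicator_of_mem hx]
      congr 1
      ext b
      simp [mem_congr_of_cylinderEvents hC (hupd b), hx]
    · rw [Set.indicator_of_notMem hx]
      convert measure_empty (μ := K v x)
      ext b
      simp [mem_congr_of_cylinderEvents hC (hupd b), hx]

end Resampling

/-! ### Transfinite construction of the resampling kernels -/

section Existence

variable {V : Type*} [LinearOrder V] [WellFoundedLT V] {X : V → Type*}
  [∀ v, MeasurableSpace (X v)] {K : ∀ v, Kernel (∀ v, X v) (X v)} {I : Set V}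

/-- The full product space is the state space of a Markov chain whose `n`-th transition resamples `J
(n + 1) \ J n`. Each coordinate settles at a finite time, and the limit point collects the settled
values. -/
theorem exists_isResamplingKernel_iUnion (hK : DependsOnPast K) {J : ℕ → Set V} (hJ0 : J 0 = ∅)
    (hmono : Monotone J) (hlow : ∀ n, ∀ i ∈ J n, ∀ j ∈ ⋃ n, J n, j < i → j ∈ J n)
    (hgood : ∀ n, ∃ P, IsResamplingKernel K (J (n + 1) \ J n) P) :
    ∃ P, IsResamplingKernel K (⋃ n, J n) P := by
  classical
  set I := ⋃ n, J n with hI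
  have hJI : ∀ n, J n ⊆ I := Set.subset_iUnion J
  choose Q hQ using hgood
  have hQm : ∀ n, IsMarkovKernel (Q n) := fun n => (hQ n).isMarkovKernel
  obtain ⟨T, hT, hT0, hTs⟩ := exists_markovChain Q
  have hev : ∀ n, Measurable fun ω : ℕ → ∀ v, X v => ω n := measurable_pi_apply
  have hres : ∀ x n, IsResampling K (J n) x ((T x).map fun ω => ω n) := by
    intro x n
    induction n with
    | zero => rw [hT0, hJ0]; exact isResampling_dirac x
    | succ n ih =>
      have h1 : (T x).map (fun ω => ω (n + 1)) = ((T x).map fun ω => ω n).bind (Q n) := by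
        ext D hD
        have := hTs x n Set.univ D MeasurableSet.univ hD
        rw [Measure.map_apply (hev _) hD, Measure.bind_apply hD (Q n).aemeasurable,
          ← setLIntegral_univ, ← this]
        simp [Set.preimage]
      have h2 : J (n + 1) = J n ∪ (J (n + 1) \ J n) :=
        (Set.union_sdiff_cancel (hmono n.le_succ)).symm
      rw [h1, h2]
      refine ih.bind hK (hQ n) fun i hi j hj => lt_of_not_ge fun hji => hj.2 ?_
      rcases hji.eq_or_lt with rfl | hlt
      · exact hi
      · exact hlow n i hi j (hJI _ hj.1) hlt
  have hkeep : ∀ x n D, MeasurableSet[cylinderEvents (J (n + 1) \ J n)ᶜ] D →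
      ∀ᵐ ω ∂T x, ω n ∈ D → ω (n + 1) ∈ D := by
    intro x n D hD
    have hDm := hD.of_cylinderEvents
    have h := hTs x n D Dᶜ hDm hDm.compl
    rw [setLIntegral_congr_fun (g := fun _ => 0) hDm fun y hy => ?_, lintegral_zero] at h
    · rw [ae_iff]
      simpa using h
    · rw [(hQ n y).apply_eq_indicator hK hD.compl]
      exact Set.indicator_of_notMem (Set.notMem_compl_iff.2 hy) _
  -- The coordinates that are settled at time `n`.
  let S : ℕ → Set V := fun n => Iᶜ ∪ J n
  have hae : ∀ x m n, m ≤ n → ∀ v ∈ S m, ∀ B : Set (X v), MeasurableSet B →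
      ∀ᵐ ω ∂T x, ω m v ∈ B ↔ ω n v ∈ B := by
    intro x m n hmn v hv B hB
    induction n, hmn using Nat.le_induction with
    | base => exact Filter.Eventually.of_forall fun _ => Iff.rfl
    | succ n hmn ih =>
      have hvn : v ∈ (J (n + 1) \ J n)ᶜ := fun hvJ =>
        hv.elim (fun h => h (hJI _ hvJ.1)) fun h => hvJ.2 (hmono hmn h)
      filter_upwards [ih, hkeep x n _ (measurableSet_eval_preimage hvn hB),
        hkeep x n _ (measurableSet_eval_preimage hvn hB.compl)] with ω h1 h2 h3
      exact h1.trans ⟨h2, not_imp_not.1 h3⟩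
  have hex : ∀ v, ∃ n, v ∈ S n := fun v => by
    by_cases hv : v ∈ I
    · obtain ⟨n, hn⟩ := Set.mem_iUnion.1 hv
      exact ⟨n, .inr hn⟩
    · exact ⟨0, .inl hv⟩
  let L : (ℕ → ∀ v, X v) → ∀ v, X v := fun ω v => ω (Nat.find (hex v)) v
  have hLm : Measurable L :=
    measurable_pi_lambda _ fun v => (measurable_pi_apply v).comp (hev _)
  have hL : ∀ x n C, MeasurableSet[cylinderEvents (S n)] C → ∀ᵐ ω ∂T x, L ω ∈ C ↔ ω n ∈ C := by
    intro x n
    -- Almost sure agreement is available per event, not simultaneously for uncountably many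
    -- coordinates. The events with agreement form a σ-algebra, so generators suffice.
    let m : MeasurableSpace (∀ v, X v) :=
      { MeasurableSet' := fun C => ∀ᵐ ω ∂T x, L ω ∈ C ↔ ω n ∈ C
        measurableSet_empty := by simp
        measurableSet_compl := fun C hC => by
          filter_upwards [hC] with ω h using not_congr h
        measurableSet_iUnion := fun f hf => by
          filter_upwards [ae_all_iff.2 hf] with ω h
          simp only [Set.mem_iUnion, h] }
    suffices cylinderEvents (S n) ≤ m from this
    refine iSup₂_le fun v hv => ?_
    rintro _ ⟨B, hB, rfl⟩
    exact hae x _ n (Nat.find_min' (hex v) hv) v (Nat.find_spec (hex v)) B hB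
  refine ⟨T.map L, fun x => ?_⟩
  rw [Kernel.map_apply _ hLm]
  refine IsResampling.of_locally hK (Measure.isProbabilityMeasure_map hLm.aemeasurable)
    fun v => ?_
  obtain ⟨n, hn⟩ := hex v
  have hvI : v ∈ I → v ∈ J n := fun h => hn.resolve_left (not_not_intro h)
  refine ⟨S n, J n, _, hres x n, hn, ⟨hvI, fun h => hJI n h⟩, fun hv u hu => ?_, fun C hC => ?_⟩
  · by_cases huI : u ∈ I
    · exact .inr (hlow n v (hvI hv) u huI hu)
    · exact .inl huI
  · have hCm := hC.of_cylinderEvents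
    rw [Measure.map_apply hLm hCm, Measure.map_apply (hev n) hCm]
    refine measure_congr ?_
    filter_upwards [hL x n C hC] with ω h using propext h

/-- The limit step at a set in which every sequence is bounded. -/
theorem exists_isResamplingKernel_of_bounded (hK : DependsOnPast K) (hne : I.Nonempty)
    (hbdd : ∀ s : ℕ → V, (∀ n, s n ∈ I) → ∃ u ∈ I, ∀ n, s n ≤ u)
    (hgood : ∀ u ∈ I, ∃ P, IsResamplingKernel K (I ∩ Set.Iic u) P) :
    ∃ P, IsResamplingKernel K I P := by
  have hgood' : ∀ u : I, ∃ P, IsResamplingKernel K (I ∩ Set.Iic u.1) P := fun u => hgood u u.2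
  choose P hP using hgood'
  let S : V → Set V := fun u => Iᶜ ∪ Set.Iic u
  have hSmono : Monotone S := fun u w h => Set.union_subset_union_right _ (Set.Iic_subset_Iic.2 h)
  -- Countably many stages have a common bound in `I`, so the σ-algebras of the stages have a union
  -- closed under countable unions.
  have hdet : ∀ A : Set (∀ v, X v), MeasurableSet A →
      ∃ u : I, MeasurableSet[cylinderEvents (S u)] A := by
    let m : MeasurableSpace (∀ v, X v) :=
      { MeasurableSet' := fun A => ∃ u : I, MeasurableSet[cylinderEvents (S u)] A
        measurableSet_empty := ⟨⟨_, hne.some_mem⟩, @MeasurableSet.empty _ (_)⟩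
        measurableSet_compl := fun A ⟨u, hu⟩ => ⟨u, hu.compl⟩
        measurableSet_iUnion := fun f hf => by
          choose s hs using hf
          obtain ⟨u, hu, hsu⟩ := hbdd (fun n => s n) fun n => (s n).2
          exact ⟨⟨u, hu⟩, .iUnion fun n => cylinderEvents_mono (hSmono (hsu n)) _ (hs n)⟩ }
    suffices MeasurableSpace.pi ≤ m from this
    refine iSup_le fun v => ?_
    rintro _ ⟨B, hB, rfl⟩
    by_cases hv : v ∈ I
    · have hvS : v ∈ S v := Or.inr le_rfl
      exact ⟨⟨v, hv⟩, measurableSet_eval_preimage hvS hB⟩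
    · have hvS : v ∈ S hne.some := Or.inl hv
      exact ⟨⟨_, hne.some_mem⟩, measurableSet_eval_preimage hvS hB⟩
  have hcons : ∀ x (u w : I), u ≤ w → ∀ A, MeasurableSet[cylinderEvents (S u)] A →
      P u x A = P w x A := by
    intro x u w huw A hA
    refine (hP u x).measure_eq hK (hP w x) (fun s hs => ⟨⟨fun h => ⟨h.1, h.2.trans huw⟩,
      fun h => ⟨h.1, hs.resolve_left (not_not_intro h.1)⟩⟩, fun h => ?_⟩) hA
    exact fun r hr => Or.inr (le_of_lt (lt_of_lt_of_le hr h.2))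
  have hcons' : ∀ x (u w : I) A, MeasurableSet[cylinderEvents (S u)] A →
      MeasurableSet[cylinderEvents (S w)] A → P u x A = P w x A := by
    intro x u w A hu hw
    rcases le_total u w with h | h
    · exact hcons x u w h A hu
    · exact (hcons x w u h A hw).symm
  choose U hU using hdet
  -- Each event is measured at its own stage `U`; a countable disjoint family is moved to one common
  -- stage for additivity. As `U` does not depend on `x`, measurability in `x` is inherited.
  let μ : (∀ v, X v) → Measure (∀ v, X v) := fun x =>
    Measure.ofMeasurable (fun A hA => P (U A hA) x A) (measure_empty) (by
      intro f hf hd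
      obtain ⟨u, hu, hsu⟩ := hbdd (fun n => U (f n) (hf n)) fun n => (U (f n) (hf n)).2
      have hfu : ∀ n, MeasurableSet[cylinderEvents (S u)] (f n) := fun n =>
        cylinderEvents_mono (hSmono (hsu n)) _ (hU (f n) (hf n))
      rw [hcons' x _ ⟨u, hu⟩ _ (hU _ _) (MeasurableSet.iUnion hfu), measure_iUnion hd hf]
      exact tsum_congr fun n => hcons' x _ _ _ (hfu n) (hU _ _))
  have hμ : ∀ x A (hA : MeasurableSet A), μ x A = P (U A hA) x A := fun x A hA =>
    Measure.ofMeasurable_apply A hA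
  have hμu : ∀ x (u : I) A, MeasurableSet[cylinderEvents (S u)] A → μ x A = P u x A :=
    fun x u A hA => (hμ x A hA.of_cylinderEvents).trans (hcons' x _ _ _ (hU _ _) hA)
  have hprob : ∀ x, IsProbabilityMeasure (μ x) := fun x => by
    have := (hP (U Set.univ MeasurableSet.univ) x).prob
    exact ⟨by rw [hμ x _ MeasurableSet.univ, measure_univ]⟩
  refine ⟨⟨μ, Measure.measurable_of_measurable_coe _ fun A hA => ?_⟩, fun x => ?_⟩
  · simp_rw [fun x => hμ x A hA]
    exact Kernel.measurable_coe _ hA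
  · refine IsResampling.of_locally hK (hprob x) fun v => ?_
    by_cases hv : v ∈ I
    · exact ⟨S v, _, _, hP ⟨v, hv⟩ x, .inr le_rfl, by simp [hv],
        fun _ u hu => .inr (le_of_lt hu), hμu x ⟨v, hv⟩⟩
    · exact ⟨S hne.some, _, _, hP ⟨_, hne.some_mem⟩ x, .inl hv, by simp [hv],
        fun h => (hv h).elim, hμu x ⟨_, hne.some_mem⟩⟩

/-- Either all sequences in `I` are bounded in `I`, or an unbounded one exhausts `I` by countably
many initial segments. -/
theorem exists_isResamplingKernel_of_initial (hK : DependsOnPast K)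
    (hgood : ∀ u ∈ I, ∀ J ⊆ I ∩ Set.Iic u, ∃ P, IsResamplingKernel K J P) :
    ∃ P, IsResamplingKernel K I P := by
  rcases I.eq_empty_or_nonempty with rfl | hne
  · exact ⟨_, isResamplingKernel_id⟩
  by_cases hbdd : ∀ s : ℕ → V, (∀ n, s n ∈ I) → ∃ u ∈ I, ∀ n, s n ≤ u
  · exact exists_isResamplingKernel_of_bounded hK hne hbdd fun u hu => hgood u hu _ subset_rfl
  push Not at hbdd
  obtain ⟨s, hsI, hs⟩ := hbdd
  let J : ℕ → Set V := fun n => {u | u ∈ I ∧ ∃ k < n, u ≤ s k}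
  have hJI : ⋃ n, J n = I := by
    refine subset_antisymm (Set.iUnion_subset fun n u hu => hu.1) fun u hu => ?_
    obtain ⟨k, hk⟩ := hs u hu
    exact Set.mem_iUnion.2 ⟨k + 1, hu, k, k.lt_succ_self, hk.le⟩
  rw [← hJI]
  refine exists_isResamplingKernel_iUnion hK (by simp [J])
    (fun m n hmn u ⟨hu, k, hk, h⟩ => ⟨hu, k, hk.trans_le hmn, h⟩)
    (fun n i ⟨_, k, hk, h⟩ j hj hji => ⟨hJI ▸ hj, k, hk, hji.le.trans h⟩) fun n => ?_
  -- The sequence need not be monotone; the block lies below the maximum of its first `n + 1` terms.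
  obtain ⟨k, -, hk⟩ := Finset.exists_max_image (Finset.range (n + 1)) s ⟨0, by simp⟩
  refine hgood (s k) (hsI k) _ ?_
  rintro u ⟨⟨hu, l, hl, h⟩, -⟩
  exact ⟨hu, h.trans (hk l (Finset.mem_range.2 hl))⟩

/-- A transfinite version of the Ionescu-Tulcea theorem. -/
theorem exists_isResamplingKernel [∀ v, IsMarkovKernel (K v)] (hK : DependsOnPast K) (I : Set V) :
    ∃ P, IsResamplingKernel K I P := by
  have main : ∀ w, ∀ J ⊆ Set.Iic w, ∃ P, IsResamplingKernel K J P := by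
    intro w
    induction w using WellFoundedLT.induction with
    | _ w ih =>
      have hlt : ∀ J ⊆ Set.Iio w, ∃ P, IsResamplingKernel K J P := fun J hJ =>
        exists_isResamplingKernel_of_initial hK fun u hu J' hJ' =>
          ih u (hJ hu) J' (hJ'.trans Set.inter_subset_right)
      intro J hJ
      have hJw : J \ {w} ⊆ Set.Iio w := fun u hu => lt_of_le_of_ne (hJ hu.1) hu.2
      by_cases hw : w ∈ J
      · obtain ⟨P, hP⟩ := hlt _ hJw
        obtain ⟨Q, hQ⟩ := exists_isResamplingKernel_singleton hK w
        refine ⟨Q ∘ₖ P, fun x => ?_⟩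
        rw [Kernel.comp_apply, ← Set.sdiff_union_of_subset (Set.singleton_subset_iff.2 hw)]
        exact (hP x).bind hK hQ fun i hi j hj => hj ▸ hJw hi
      · exact hlt J fun u hu => lt_of_le_of_ne (hJ hu) fun h => hw (h ▸ hu)
  exact exists_isResamplingKernel_of_initial hK fun u _ J hJ =>
    main u J (hJ.trans Set.inter_subset_right)

end Existence

/-! ## Networks -/

section Factorization

variable {V : Type*} [LinearOrder V] [WellFoundedLT V] {X : V → Type*}
  [∀ v, MeasurableSpace (X v)] {K : ∀ v, Kernel (∀ v, X v) (X v)}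

/-- The conditional law of a resampled coordinate given any ancestor-closed set of coordinates that
contains its parents, possibly later ones in the order, is given by its kernel. -/
theorem IsResampling.measure_inter_eq_setLIntegral {pa : V → Set V}
    (hpa : ∀ v, pa v ⊆ Set.Iio v)
    (hK : ∀ v (B : Set (X v)), MeasurableSet B → Measurable[cylinderEvents (pa v)] fun y => K v y B)
    {x : ∀ v, X v} {μ : Measure (∀ v, X v)} (h : IsResampling K Set.univ x μ) {N : Set V}
    (hN : ∀ s ∈ N, pa s ⊆ N) {v : V} (hv : v ∉ N) {C : Set (∀ v, X v)}
    (hC : MeasurableSet[cylinderEvents N] C) {B : Set (X v)} (hB : MeasurableSet B) :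
    μ (C ∩ (fun y => y v) ⁻¹' B) = ∫⁻ y in C, K v y B ∂μ := by
  have := h.prob
  have hpred : DependsOnPast K := fun v B hB =>
    (hK v B hB).mono (cylinderEvents_mono (hpa v)) le_rfl
  have hKm : ∀ v (B : Set (X v)), MeasurableSet B → Measurable fun y => K v y B := fun v B hB =>
    (hK v B hB).mono cylinderEvents_le_pi le_rfl
  have hBm : ∀ s (B : Set (X s)), MeasurableSet B →
      MeasurableSet ((fun y : ∀ v, X v => y s) ⁻¹' B) :=
    fun s B hB => measurable_pi_apply s hB
  have hstep : ∀ s (D : Set (X s)), MeasurableSet D →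
      ∀ C, MeasurableSet[cylinderEvents (Set.Iio s)] C →
      μ.restrict ((fun y => y s) ⁻¹' D) C = μ.withDensity (fun y => K s y D) C := by
    intro s D hD C hC
    rw [Measure.restrict_apply hC.of_cylinderEvents, withDensity_apply _ hC.of_cylinderEvents]
    exact h.step s trivial C hC D hD
  have hden : ∀ s (D : Set (X s)), MeasurableSet D → ∀ f, Measurable f → ∀ C, MeasurableSet C →
      ∫⁻ y in C, f y ∂μ.withDensity (fun y => K s y D) = ∫⁻ y in C, K s y D * f y ∂μ := by
    intro s D hD f hf C hC
    rw [restrict_withDensity hC, lintegral_withDensity_eq_lintegral_mul _ (hKm s D hD) hf]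
    rfl
  -- For fixed `B`, both sides are finite measures in `C`, to be compared on the coordinates in `N`.
  suffices μ.restrict ((fun y => y v) ⁻¹' B) C = μ.withDensity (fun y => K v y B) C by
    rwa [Measure.restrict_apply hC.of_cylinderEvents,
      withDensity_apply _ hC.of_cylinderEvents] at this
  have huniv := hstep v B hB Set.univ (@MeasurableSet.univ _ (_))
  refine measure_eq_on_cylinderEvents huniv (fun s hs heq C hC D hD => ?_) hC
  have hCs := cylinderEvents_mono (X := X) Set.inter_subset_right _ hC
  have hCm := hC.of_cylinderEvents
  rcases lt_trichotomy s v with hsv | rfl | hvs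
  · have hCv := cylinderEvents_mono (X := X) (Set.Iio_subset_Iio hsv.le) _ hCs
    exact hstep v B hB _ (hCv.inter (measurableSet_eval_preimage (Set.mem_Iio.2 hsv) hD))
  · exact (hv hs).elim
  -- Closure of `N` under parents makes the kernel of `s` measurable where the induction hypothesis
  -- applies.
  · have hpas : pa s ⊆ N ∩ Set.Iio s := Set.subset_inter (hN s hs) (hpa s)
    have hBs : MeasurableSet[cylinderEvents (Set.Iio s)] ((fun y : ∀ v, X v => y v) ⁻¹' B) :=
      measurableSet_eval_preimage (Set.mem_Iio.2 hvs) hB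
    calc μ.restrict ((fun y => y v) ⁻¹' B) (C ∩ (fun y => y s) ⁻¹' D)
        = μ ((C ∩ (fun y => y v) ⁻¹' B) ∩ (fun y => y s) ⁻¹' D) := by
          rw [Measure.restrict_apply (hCm.inter (hBm s D hD)), Set.inter_right_comm]
      _ = ∫⁻ y in C, K s y D ∂μ.restrict ((fun y => y v) ⁻¹' B) := by
          rw [h.step s trivial _ (hCs.inter hBs) D hD, Measure.restrict_restrict hCm]
      _ = ∫⁻ y in C, K s y D ∂μ.withDensity (fun y => K v y B) :=
          setLIntegral_congr_of_measure_eq_on cylinderEvents_le_pi heq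
            ((hK s D hD).mono (cylinderEvents_mono hpas) le_rfl) hC
      _ = ∫⁻ y in C, K v y B * K s y D ∂μ := hden v B hB _ (hKm s D hD) C hCm
      _ = ∫⁻ y in C, K s y D * K v y B ∂μ := by simp_rw [mul_comm]
      _ = ∫⁻ y in C, K v y B ∂μ.withDensity (fun y => K s y D) :=
          (hden s D hD _ (hKm v B hB) C hCm).symm
      _ = ∫⁻ y in C, K v y B ∂μ.restrict ((fun y => y s) ⁻¹' D) :=
          (setLIntegral_congr_of_measure_eq_on cylinderEvents_le_pi (hstep s D hD)
            ((hpred v B hB).mono (cylinderEvents_mono (Set.Iio_subset_Iio hvs.le)) le_rfl)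
            hCs).symm
      _ = μ.withDensity (fun y => K v y B) (C ∩ (fun y => y s) ⁻¹' D) := by
          rw [withDensity_apply _ (hCm.inter (hBm s D hD)), Measure.restrict_restrict hCm]

end Factorization

theorem WellFoundedDigraph.wellFounded {V : Type*} {E : V → V → Prop}
    (h : WellFoundedDigraph E) : WellFounded E :=
  wellFounded_iff_isEmpty_descending_chain.2 ⟨fun a => h ⟨a.1, a.2⟩⟩

/-! ### Factorization, conditional independence and representation -/

namespace MTBN

variable {V : Type*} (M : MTBN V)

theorem sigma_eq_cylinderEvents (U : Set V) : M.sigma U = cylinderEvents U :=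
  (cylinderEvents_eq_comap U).symm

theorem sigma_le (U : Set V) : M.sigma U ≤ MeasurableSpace.pi :=
  M.sigma_eq_cylinderEvents U ▸ cylinderEvents_le_pi

theorem sigma_mono {U W : Set V} (h : U ⊆ W) : M.sigma U ≤ M.sigma W := by
  rw [sigma_eq_cylinderEvents, sigma_eq_cylinderEvents]
  exact cylinderEvents_mono h

/-- The kernel of a vertex as a function of all coordinates. -/
noncomputable def liftKernel (v : V) : Kernel (∀ v, M.X v) (M.X v) :=
  (M.K v).comap (fun x u => x u.1) (measurable_pi_lambda _ fun u => measurable_pi_apply u.1)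

instance (v : V) : IsMarkovKernel (M.liftKernel v) := by
  have := M.markov v
  unfold liftKernel
  infer_instance

theorem measurable_liftKernel (v : V) {B : Set (M.X v)} (hB : MeasurableSet B) :
    Measurable[M.sigma (M.pa v)] fun x => M.liftKernel v x B :=
  (Kernel.measurable_coe (M.K v) hB).comp (comap_measurable _)

theorem not_reachable_of_edge {u v : V} (h : M.Edge u v) :
    ¬ Relation.ReflTransGen M.Edge v u := fun hr =>
  (WellFounded.transGen M.wellFounded.wellFounded).irrefl.irrefl _
    (Relation.TransGen.tail' hr h)

theorem pa_subset_nd (v : V) : M.pa v ⊆ M.nd v := fun _ hu => M.not_reachable_of_edge hu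

theorem pa_subset_nd_of_mem {v s : V} (hs : s ∈ M.nd v) : M.pa s ⊆ M.nd v :=
  fun _ hu hr => hs (hr.tail hu)

theorem notMem_nd (v : V) : v ∉ M.nd v := fun h => h .refl

/-- For every vertex `v`, the kernel of `v` is the conditional law of `X_v` given all its
non-descendants. -/
def Factorizes (μ : Measure (∀ v, M.X v)) : Prop :=
  ∀ v C, MeasurableSet[M.sigma (M.nd v)] C → ∀ B : Set (M.X v), MeasurableSet B →
    μ (C ∩ (fun x => x v) ⁻¹' B) = ∫⁻ x in C, M.liftKernel v x B ∂μ

variable {M} {μ : Measure (∀ v, M.X v)}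

theorem setIntegral_liftKernel (v : V) {B : Set (M.X v)} (hB : MeasurableSet B)
    (C : Set (∀ v, M.X v)) :
    ∫ x in C, (M.liftKernel v x B).toReal ∂μ = (∫⁻ x in C, M.liftKernel v x B ∂μ).toReal :=
  integral_toReal (Kernel.measurable_coe _ hB).aemeasurable
    (Filter.Eventually.of_forall fun _ => measure_lt_top _ _)

theorem setIntegral_indicator_one {A C : Set (∀ v, M.X v)} (hA : MeasurableSet A) :
    ∫ x in C, A.indicator (fun _ => (1 : ℝ)) x ∂μ = (μ (C ∩ A)).toReal := by
  rw [setIntegral_indicator hA, setIntegral_const, smul_eq_mul, mul_one, measureReal_def]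

theorem stronglyMeasurable_liftKernel (v : V) {B : Set (M.X v)} (hB : MeasurableSet B) :
    StronglyMeasurable[M.sigma (M.pa v)] fun x => (M.liftKernel v x B).toReal :=
  (M.measurable_liftKernel v hB).ennreal_toReal.stronglyMeasurable

theorem norm_liftKernel_le (v : V) (B : Set (M.X v)) (x : ∀ v, M.X v) :
    ‖(M.liftKernel v x B).toReal‖ ≤ 1 := by
  rw [Real.norm_of_nonneg ENNReal.toReal_nonneg]
  exact ENNReal.toReal_le_of_le_ofReal zero_le_one (by simpa using prob_le_one)

variable [IsProbabilityMeasure μ]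

theorem integrable_liftKernel (v : V) {B : Set (M.X v)} (hB : MeasurableSet B) :
    Integrable (fun x => (M.liftKernel v x B).toReal) μ :=
  .of_bound (((stronglyMeasurable_liftKernel v hB).mono (M.sigma_le _)).aestronglyMeasurable) 1
    (Filter.Eventually.of_forall (norm_liftKernel_le v B))

theorem condExp_indicator_mul_liftKernel (v : V) {B : Set (M.X v)} (hB : MeasurableSet B)
    {C : Set (∀ v, M.X v)} (hC : MeasurableSet C) :
    μ[C.indicator fun x => (M.liftKernel v x B).toReal | M.sigma (M.pa v)] =ᵐ[μ]
      (fun x => (M.liftKernel v x B).toReal) * μ⟦C | M.sigma (M.pa v)⟧ := by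
  have h := condExp_stronglyMeasurable_mul_of_bound (μ := μ) (M.sigma_le _)
    (stronglyMeasurable_liftKernel v hB) (g := C.indicator fun _ => (1 : ℝ))
    ((integrable_const _).indicator hC) 1 (Filter.Eventually.of_forall (norm_liftKernel_le v B))
  have h2 : ((fun x => (M.liftKernel v x B).toReal) * C.indicator fun _ => (1 : ℝ)) =
      C.indicator fun x => (M.liftKernel v x B).toReal := by
    ext x
    by_cases hx : x ∈ C <;> simp [hx]
  rwa [h2] at h

/-- Parents are non-descendants, so the factorization may be tested on `D ∩ C` with `D` an event of
the parents; the kernel is then pulled out of the conditional expectation. -/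
theorem Factorizes.condExp_inter (h : M.Factorizes μ) (v : V) {B : Set (M.X v)}
    (hB : MeasurableSet B) {C : Set (∀ v, M.X v)} (hC : MeasurableSet[M.sigma (M.nd v)] C) :
    μ⟦(fun x : ∀ v, M.X v => x v) ⁻¹' B ∩ C | M.sigma (M.pa v)⟧ =ᵐ[μ]
      (fun x => (M.liftKernel v x B).toReal) * μ⟦C | M.sigma (M.pa v)⟧ := by
  have hCm := M.sigma_le _ _ hC
  have hBm : MeasurableSet ((fun x : ∀ v, M.X v => x v) ⁻¹' B) := measurable_pi_apply v hB
  refine Filter.EventuallyEq.trans ?_ (condExp_indicator_mul_liftKernel v hB hCm)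
  symm
  refine ae_eq_condExp_of_forall_setIntegral_eq (M.sigma_le _)
    ((integrable_const _).indicator (hBm.inter hCm)) (fun _ _ _ => integrable_condExp.integrableOn)
    (fun D hD _ => ?_) stronglyMeasurable_condExp.aestronglyMeasurable
  rw [setIntegral_condExp (M.sigma_le _) ((integrable_liftKernel v hB).indicator hCm) hD,
    setIntegral_indicator hCm, setIntegral_liftKernel v hB,
    ← h v _ ((M.sigma_mono (M.pa_subset_nd v) _ hD).inter hC) B hB,
    setIntegral_indicator_one (hBm.inter hCm), Set.inter_assoc, Set.inter_comm C]

theorem Factorizes.condExp_eq (h : M.Factorizes μ) (v : V) {B : Set (M.X v)}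
    (hB : MeasurableSet B) :
    (fun x => (M.liftKernel v x B).toReal) =ᵐ[μ]
      μ⟦(fun x : ∀ v, M.X v => x v) ⁻¹' B | M.sigma (M.pa v)⟧ := by
  have h1 := h.condExp_inter v hB (C := Set.univ) (@MeasurableSet.univ _ (_))
  rw [Set.inter_univ, Set.indicator_univ, condExp_const (M.sigma_le _)] at h1
  filter_upwards [h1] with x hx
  simp [hx]

theorem Factorizes.represents (h : M.Factorizes μ) : M.Represents μ := by
  refine fun v => ⟨fun A C hA hC => ?_, fun B hB => h.condExp_eq v hB⟩
  obtain ⟨B, hB, rfl⟩ : ∃ B : Set (M.X v), MeasurableSet B ∧ (fun x => x v) ⁻¹' B = A := by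
    rw [sigma_eq_cylinderEvents, cylinderEvents, iSup_singleton] at hA
    exact hA
  filter_upwards [h.condExp_inter v hB hC, h.condExp_eq v hB] with x h1 h2
  rw [h1, Pi.mul_apply, Pi.mul_apply, h2]

/-- Conditional independence turns the kernel times the conditional probability of `C` into the
conditional probability of the intersection; taking expectations gives the claim. -/
theorem Represents.factorizes (h : M.Represents μ) : M.Factorizes μ := by
  intro v C hC B hB
  obtain ⟨hind, hker⟩ := h v
  have hCm := M.sigma_le _ _ hC
  have hBm : MeasurableSet ((fun x : ∀ v, M.X v => x v) ⁻¹' B) := measurable_pi_apply v hB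
  have hBs : MeasurableSet[M.sigma {v}] ((fun x : ∀ v, M.X v => x v) ⁻¹' B) := by
    rw [sigma_eq_cylinderEvents]
    exact measurableSet_eval_preimage (Set.mem_singleton v) hB
  have hfin : ∫⁻ x in C, M.liftKernel v x B ∂μ ≠ ∞ := by
    refine ne_top_of_le_ne_top (measure_ne_top μ C) ?_
    rw [← setLIntegral_one]
    exact lintegral_mono fun x => prob_le_one
  rw [← ENNReal.toReal_eq_toReal_iff' (measure_ne_top _ _) hfin, ← setIntegral_liftKernel v hB,
    ← integral_indicator hCm, ← integral_condExp (M.sigma_le (M.pa v)),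
    integral_congr_ae (condExp_indicator_mul_liftKernel v hB hCm)]
  have h1 := hind _ C hBs hC
  have h2 : ((fun x => (M.liftKernel v x B).toReal) * μ⟦C | M.sigma (M.pa v)⟧) =ᵐ[μ]
      μ⟦(fun x : ∀ v, M.X v => x v) ⁻¹' B ∩ C | M.sigma (M.pa v)⟧ := by
    filter_upwards [h1, hker B hB] with x h3 h4
    rw [h3, Pi.mul_apply, Pi.mul_apply, ← h4]
    rfl
  rw [integral_congr_ae h2, integral_condExp (M.sigma_le _), ← setIntegral_univ,
    setIntegral_indicator_one (hBm.inter hCm), Set.univ_inter, Set.inter_comm]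

/-- A measure-theoretic Bayesian network (with nonempty spaces) represents a unique probability
measure. -/
theorem existsUnique_represents (M : MTBN V) [hne : Nonempty (∀ v, M.X v)] :
    ∃! μ : Measure (∀ v, M.X v), IsProbabilityMeasure μ ∧ M.Represents μ := by
  have hwf : IsWellFounded V M.Edge := ⟨M.wellFounded.wellFounded⟩
  let _ : LinearOrder V := IsWellFounded.wellOrderExtension M.Edge
  have _ : WellFoundedLT V := IsWellFounded.wellOrderExtension.isWellFounded_lt M.Edge
  have hlt : ∀ u v, M.Edge u v → u < v := fun u v h =>
    Prod.Lex.left _ _ (IsWellFounded.rank_lt_of_rel h)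
  have hpa : ∀ v, M.pa v ⊆ Set.Iio v := fun v u h => hlt u v h
  have hnd : ∀ v, Set.Iio v ⊆ M.nd v := by
    have hle : ∀ v u, Relation.ReflTransGen M.Edge v u → v ≤ u := fun v u hr => by
      induction hr with
      | refl => exact le_rfl
      | tail _ h ih => exact ih.trans (hlt _ _ h).le
    exact fun v u hu hr => (hle v u hr).not_gt hu
  have hK : ∀ v (B : Set (M.X v)), MeasurableSet B →
      Measurable[cylinderEvents (M.pa v)] fun y => M.liftKernel v y B := fun v B hB => by
    rw [← sigma_eq_cylinderEvents]
    exact M.measurable_liftKernel v hB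
  have hpred : DependsOnPast M.liftKernel := fun v B hB =>
    (hK v B hB).mono (cylinderEvents_mono (hpa v)) le_rfl
  -- The starting point is immaterial, since every coordinate is resampled.
  obtain ⟨x⟩ := hne
  obtain ⟨P, hP⟩ := exists_isResamplingKernel hpred Set.univ
  have := (hP x).prob
  have hfac : M.Factorizes (P x) := fun v C hC B hB => by
    rw [sigma_eq_cylinderEvents] at hC
    exact (hP x).measure_inter_eq_setLIntegral hpa hK (fun s hs => M.pa_subset_nd_of_mem hs)
      (M.notMem_nd v) hC hB
  refine ⟨P x, ⟨(hP x).prob, hfac.represents⟩, fun μ ⟨hμ, hrep⟩ => ?_⟩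
  -- Earlier vertices are non-descendants, so any representing measure is a full resampling, and
  -- these are unique.
  have hres : IsResampling M.liftKernel Set.univ x μ :=
    { prob := hμ
      fixed := fun v hv => (hv trivial).elim
      step := fun v _ C hC B hB => hrep.factorizes v C
        (M.sigma_mono (hnd v) _ (M.sigma_eq_cylinderEvents _ ▸ hC)) B hB }
  ext A hA
  refine hres.measure_eq hpred (hP x) (S := Set.univ) (fun s _ => by simp) ?_
  rwa [cylinderEvents_univ]

end MTBN

theorem theorem5 (M : BLOG.Model) (h : WellFoundedDigraph M.Edge) :
    ∃! μ : Measure (∀ v : BLOG.BRV M.toVocab, v.Space),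
      IsProbabilityMeasure μ ∧ (M.toMTBN h).Represents μ := by
  have : Nonempty (∀ v, (M.toMTBN h).X v) := ⟨BLOG.BRV.default⟩
  exact (M.toMTBN h).existsUnique_represents
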